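/- Let $\Sigma_m=\{1,\dots,m\}$ be a finite alphabet, let $\Sigma_m^*$ be the set of finite words over $\Sigma_m$ (including the empty word $\varepsilon$), and let $|u|$ denote the length of a word $u$. For a commutative ring $R$, a function $f:\Sigma_m^*\to R$ is called $(R,m)$-regular if the $R$-module spanned by the maps $f^u:w\mapsto f(uw)$, $u\in\Sigma_m^*$, is finitely generated. A $(\mathbb{C},m)$-regular function is called $(\mathbb{C},m)$-automatic if it takes only finitely many distinct values. Let $\mathcal{R}_0(\Sigma_m)$ be the $\mathbb{C}$-algebra of functions $\Sigma_m^*\to\mathbb{C}$ generated by the $(\mathbb{C},m)$-automatic functions under pointwise addition, multiplication by complex scalars, and the convolution product $$(f\star g)(i_1\cdots i_s)=\sum_{j=0}^{s} f(i_1\cdots i_j)\,g(i_{j+1}\cdots i_s).$$ **Theorem.** Let $f:\Sigma_m^*\to\mathbb{Z}$ be $(\mathbb{Z},m)$-regular. Then the following are equivalent: (i) $f\in\mathcal{R}_0(\Sigma_m)$; (ii) there are a positive integer $d$, matrices $A_1,\dots,A_m\in\mathbb{C}^{d\times d}$ and vectors $v,w\in\mathbb{C}^d$ such that $f(u)=w^{T}A_{i_1}\cdots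 A_{i_s}v$ for every word $u=i_1\cdots i_s\in\Sigma_m^*$, and such that every matrix in the semigroup generated by $A_1,\dots,A_m$ (including the identity, as the empty product) is tame, that is, has all its eigenvalues in the set consisting of $0$ and the roots of unity; (iii) $f$ is polynomially bounded: there are real constants $k\ge 0$ and $c>0$ such that $|f(u)|\le c\,|u|^{k}$ for all nonempty words $u\in\Sigma_m^*$. -/

import Mathlib

/-! Words over the alphabet `Σ_m` are lists over `Fin m`; concatenation is `++`. -/

namespace RegularSeq

/-- The map `f^u`, `f^u(w) = f(uw)`. -/
def shift {m : ℕ} {M : Type*} (f : List (Fin m) → M) (u : List (Fin m)) : List (Fin m) → M :=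
  fun w => f (u ++ w)

/-- `f : Σ_m^* → M` is `(R, m)`-regular: the `R`-module spanned by all the maps `f^u` is finitely
generated. -/
def IsRegular (R : Type*) {m : ℕ} {M : Type*} [CommRing R] [AddCommGroup M] [Module R M]
    (f : List (Fin m) → M) : Prop :=
  (Submodule.span R (Set.range (shift f))).FG

/-- A `(ℂ, m)`-automatic sequence: a `(ℂ, m)`-regular sequence with finitely many values. -/
def IsAutomatic {m : ℕ} (f : List (Fin m) → ℂ) : Prop :=
  IsRegular ℂ f ∧ (Set.range f).Finite

/-! ### The convolution algebra -/

/-- The convolution product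
`(f ⋆ g)(i₁ ⋯ iₛ) = ∑_{j = 0}^{s} f(i₁ ⋯ iⱼ) g(iⱼ₊₁ ⋯ iₛ)`. -/
def conv {m : ℕ} (f g : List (Fin m) → ℂ) : List (Fin m) → ℂ :=
  fun w => ∑ j ∈ Finset.range (w.length + 1), f (w.take j) * g (w.drop j)

theorem conv_nil {m : ℕ} (f g : List (Fin m) → ℂ) : conv f g [] = f [] * g [] := by
  simp [conv]

theorem conv_cons {m : ℕ} (f g : List (Fin m) → ℂ) (a : Fin m) (w : List (Fin m)) :
    conv f g (a :: w) = conv (shift f [a]) g w + f [] * g (a :: w) := by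
  simp [conv, shift, Finset.sum_range_succ' _ (w.length + 1)]

theorem conv_add {m : ℕ} (f g h : List (Fin m) → ℂ) : conv f (g + h) = conv f g + conv f h := by
  funext w
  simp [conv, mul_add, Finset.sum_add_distrib]

theorem add_conv {m : ℕ} (f g h : List (Fin m) → ℂ) : conv (f + g) h = conv f h + conv g h := by
  funext w
  simp [conv, add_mul, Finset.sum_add_distrib]

theorem smul_conv {m : ℕ} (c : ℂ) (f g : List (Fin m) → ℂ) : conv (c • f) g = c • conv f g := by
  funext w
  simp [conv, mul_assoc, Finset.mul_sum]

theorem conv_smul {m : ℕ} (c : ℂ) (f g : List (Fin m) → ℂ) : conv f (c • g) = c • conv f g := by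
  funext w
  simp [conv, mul_left_comm, Finset.mul_sum]

/-- The unit of the convolution product: the indicator function of the empty word. -/
def convOne (m : ℕ) : List (Fin m) → ℂ := fun w => if w = [] then 1 else 0

theorem zero_conv {m : ℕ} (f : List (Fin m) → ℂ) : conv 0 f = 0 := by
  funext w
  simp [conv]

theorem conv_zero {m : ℕ} (f : List (Fin m) → ℂ) : conv f 0 = 0 := by
  funext w
  simp [conv]

theorem shift_convOne {m : ℕ} (a : Fin m) : shift (convOne m) [a] = 0 := by
  funext w
  simp [shift, convOne]

theorem one_conv {m : ℕ} (f : List (Fin m) → ℂ) : conv (convOne m) f = f := by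
  funext w
  cases w with
  | nil => simp [conv_nil, convOne]
  | cons a w => rw [conv_cons, shift_convOne, zero_conv]; simp [convOne]

theorem conv_one {m : ℕ} (f : List (Fin m) → ℂ) : conv f (convOne m) = f := by
  funext w
  induction w generalizing f with
  | nil => simp [conv_nil, convOne]
  | cons a w ih => rw [conv_cons, ih]; simp [convOne, shift]

theorem conv_assoc {m : ℕ} (f g h : List (Fin m) → ℂ) :
    conv (conv f g) h = conv f (conv g h) := by
  funext w
  induction w generalizing f g with
  | nil => simp [conv_nil, mul_assoc]
  | cons a w ih =>
    have hs : shift (conv f g) [a] = conv (shift f [a]) g + f [] • shift g [a] := by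
      funext v
      simpa [shift] using conv_cons f g a v
    rw [conv_cons, conv_cons f, conv_cons g, hs, add_conv, smul_conv, conv_nil]
    simp only [Pi.add_apply, Pi.smul_apply, smul_eq_mul, ih]
    ring

/-- All functions `Σ_m^* → ℂ`, as a `ℂ`-algebra under pointwise addition and scalar
multiplication and the convolution product. -/
def ConvAlg (m : ℕ) : Type := List (Fin m) → ℂ

noncomputable instance (m : ℕ) : AddCommGroup (ConvAlg m) :=
  inferInstanceAs (AddCommGroup (List (Fin m) → ℂ))

noncomputable instance (m : ℕ) : Module ℂ (ConvAlg m) :=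
  inferInstanceAs (Module ℂ (List (Fin m) → ℂ))

noncomputable instance (m : ℕ) : Ring (ConvAlg m) :=
  { (inferInstance : AddCommGroup (ConvAlg m)) with
    mul := conv
    one := convOne m
    left_distrib := conv_add
    right_distrib := add_conv
    zero_mul := zero_conv
    mul_zero := conv_zero
    mul_assoc := conv_assoc
    one_mul := one_conv
    mul_one := conv_one }

noncomputable instance (m : ℕ) : Algebra ℂ (ConvAlg m) :=
  Algebra.ofModule smul_conv (fun c f g => conv_smul c f g)

/-- `𝓡₀(Σ_m)`: the `ℂ`-subalgebra, under the convolution product, that is generated by the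
`(ℂ, m)`-automatic sequences.  The `(ℂ, m)`-regular sequences form a subalgebra of `ConvAlg m`
containing the automatic ones, so it does not matter that the generation takes place in
`ConvAlg m`. -/
noncomputable def R₀ (m : ℕ) : Subalgebra ℂ (ConvAlg m) :=
  Algebra.adjoin ℂ {f : ConvAlg m | IsAutomatic (m := m) f}

/-! ### Tame representations -/

/-- A complex matrix is tame if each of its eigenvalues is zero or a root of unity. -/
def IsTame {d : ℕ} (B : Matrix (Fin d) (Fin d) ℂ) : Prop :=
  ∀ z : ℂ, Module.End.HasEigenvalue (Matrix.toLin' B) z → z = 0 ∨ ∃ n : ℕ, 0 < n ∧ z ^ n = 1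

/-- The semigroup generated by `𝒜` (including the identity, as the empty product) is tame if all
its elements are. -/
def GeneratesTame {d : ℕ} (𝒜 : Set (Matrix (Fin d) (Fin d) ℂ)) : Prop :=
  ∀ B ∈ Submonoid.closure 𝒜, IsTame B

/-- The product `A_u = A_{i₁} ⋯ A_{iₛ}` for `u = i₁ ⋯ iₛ`. -/
def wordProd {m d : ℕ} (A : Fin m → Matrix (Fin d) (Fin d) ℂ) (u : List (Fin m)) :
    Matrix (Fin d) (Fin d) ℂ :=
  (u.map A).prod

/-- `𝓢₀(Σ_m)`: the functions `f(u) = wᵀ A_u v` for complex matrices `A₁, …, A_m` that generate a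
tame semigroup. -/
def S₀ (m : ℕ) : Set (List (Fin m) → ℂ) :=
  {f | ∃ d : ℕ, 0 < d ∧ ∃ (A : Fin m → Matrix (Fin d) (Fin d) ℂ) (v w : Fin d → ℂ),
    GeneratesTame (Set.range A) ∧
      ∀ u : List (Fin m), f u = w ⬝ᵥ Matrix.mulVec (wordProd A u) v}

/-- `|f(u)| ≤ c |u|^k` for all nonempty words `u`, with constants `k ≥ 0` and `c > 0`. -/
def IsPolyBounded {m : ℕ} (f : List (Fin m) → ℂ) : Prop :=
  ∃ k : ℝ, 0 ≤ k ∧ ∃ c : ℝ, 0 < c ∧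
    ∀ u : List (Fin m), u ≠ [] → ‖f u‖ ≤ c * (u.length : ℝ) ^ k

/-- An integer-valued function regarded as a complex-valued one. -/
def toComplex {m : ℕ} (f : List (Fin m) → ℤ) : List (Fin m) → ℂ := fun u => (f u : ℂ)

end RegularSeq

/-! Automatic functions are bounded, and convolution preserves polynomial growth, so (i) gives
(iii). The implications (iii) ⇒ (ii) and (ii) ⇒ (i) share one criterion, `mem_S₀_and_mem_R₀`:
whenever a combination of two-sided translates of f takes the values z^n along the powers u^n of a
word, |z| ≤ 1. Polynomial growth forces this, and so does a tame representation, which serves no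
other purpose.

Under the criterion, take the integer representation of f on a basis of the module of its shifts. By
minimality its matrix entries are combinations of translates (`IsRegular.exists_rep`), so all
eigenvalues lie in the closed unit disc. Only finitely many monic integer polynomials of given
degree have all roots there, so one nonzero P kills every matrix of the semigroup
(`exists_common_annihilator`). Tameness follows, since all powers of an eigenvalue are roots of P.
For membership in 𝓡₀, induct on dimension (`coef_mem_R₀`): an irreducible semigroup killed by P is
finite, by Burnside's theorem and traces, and in the block triangular case the off-diagonal block is
a sum of convolutions of coefficients of the diagonal blocks. -/

open Module Polynomial

namespace RegularSeq

/-! ### Irreducible semigroups of endomorphisms -/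

/-- **Burnside's theorem** on irreducible sets of endomorphisms. -/
theorem adjoin_eq_top_of_irreducible {K V : Type*} [Field K] [IsAlgClosed K] [AddCommGroup V]
    [Module K V] [FiniteDimensional K V] [Nontrivial V] (S : Set (End K V))
    (h : ∀ W : Submodule K V, (∀ a ∈ S, ∀ w ∈ W, a w ∈ W) → W = ⊥ ∨ W = ⊤) :
    Algebra.adjoin K S = ⊤ := by
  classical
  set A := Algebra.adjoin K S
  have : IsSimpleModule A V := by
    have : IsSimpleOrder (Submodule A V) :=
      { exists_pair_ne := ⟨⊥, ⊤, bot_ne_top⟩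
        eq_bot_or_eq_top := fun W => by
          rcases h (W.restrictScalars K) fun a ha w hw =>
            W.smul_mem (⟨a, Algebra.subset_adjoin ha⟩ : A) hw with h0 | h0
          · left
            rwa [Submodule.restrictScalars_eq_bot_iff] at h0
          · right
            rwa [Submodule.restrictScalars_eq_top_iff] at h0 }
    exact { toIsSimpleOrder := this }
  rw [eq_top_iff]
  intro f _
  -- By Schur's lemma the commutant of A is K, so every K-linear f is linear over it and the density
  -- theorem applies.
  let F : End (End A V) V :=
    { f with
      map_smul' := fun g x => by
        obtain ⟨c, rfl⟩ := (IsSimpleModule.algebraMap_end_bijective_of_isAlgClosed K).2 g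
        simp }
  let b := Module.finBasis K V
  obtain ⟨r, hr⟩ := jacobson_density F (Finset.univ.image b)
  have : f = r := b.ext fun i => hr (b i) (by simp)
  exact this ▸ r.2

/-- A multiplicatively closed spanning set of endomorphisms killed by one nonzero polynomial is
finite. -/
theorem finite_of_span_eq_top {K V : Type*} [Field K] [IsAlgClosed K] [AddCommGroup V]
    [Module K V] [FiniteDimensional K V] (G : Submonoid (End K V))
    (hG : Submodule.span K (G : Set (End K V)) = ⊤) {P : K[X]} (hP : P ≠ 0)
    (h : ∀ g ∈ G, aeval g P = 0) : (G : Set (End K V)).Finite := by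
  classical
  set tr : End K V →ₗ[K] K := LinearMap.trace K V
  -- Each eigenvalue is a root of P and has multiplicity at most dim V, which leaves finitely many
  -- spectra.
  have htr : (tr '' G).Finite := by
    have hfin : {s : Multiset K | s ≤ finrank K V • P.roots}.Finite := Set.finite_Iic _
    refine (hfin.image Multiset.sum).subset ?_
    rintro _ ⟨g, hg, rfl⟩
    refine ⟨g.charpoly.roots, ?_,
      (End.trace_eq_sum_roots_charpoly_of_splits (IsAlgClosed.splits _)).symm⟩
    rw [Set.mem_ofPred_eq, Multiset.le_iff_count]
    intro z
    rw [Multiset.count_nsmul]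
    by_cases hz : z ∈ g.charpoly.roots
    · have h1 : g.charpoly.roots.count z ≤ finrank K V := by
        rw [← g.charpoly_natDegree]
        exact (Multiset.count_le_card _ _).trans (card_roots' _)
      have h2 : 1 ≤ P.roots.count z := by
        rw [Multiset.one_le_count_iff_mem, mem_roots hP]
        have hz' := (End.hasEigenvalue_iff_isRoot_charpoly g z).2 (isRoot_of_mem_roots hz)
        obtain ⟨v, hv⟩ := hz'.exists_hasEigenvector
        have := End.aeval_apply_of_hasEigenvector (p := P) hv
        rw [h g hg] at this
        exact (smul_eq_zero.1 this.symm).resolve_right hv.2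
      nlinarith
    · rw [Multiset.count_eq_zero_of_notMem hz]
      exact Nat.zero_le _
  obtain ⟨t, ht, hspan⟩ := Submodule.fg_span_iff_fg_span_finset_subset (G : Set (End K V)) |>.1
    (hG ▸ Module.Finite.fg_top)
  -- The trace form is nondegenerate, so g is determined by its traces against a finite spanning set
  -- t. As t lies in G, these are traces of elements of G.
  let Φ : End K V → (t → K) := fun g x => tr (g * x)
  have hΦ : Set.InjOn Φ G := by
    intro g _ g' _ hgg
    have key : ∀ x : End K V, tr (g * x) = tr (g' * x) := by
      intro x
      have hx : x ∈ Submodule.span K (t : Set (End K V)) := by rw [← hspan, hG]; trivial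
      induction hx using Submodule.span_induction with
      | mem x hx => exact congrFun hgg ⟨x, hx⟩
      | zero => simp
      | add x y _ _ hx hy => simp [mul_add, hx, hy]
      | smul c x _ hx => simp [hx]
    let b := Module.finBasis K V
    apply (LinearMap.toMatrix b b).injective
    rw [Matrix.ext_iff_trace_mul_right]
    intro X
    have := key (Matrix.toLin b b X)
    simpa [tr, LinearMap.trace_eq_matrix_trace K b, LinearMap.toMatrix_mul] using this
  refine Set.Finite.of_finite_image (Set.Finite.subset
    (Set.Finite.pi' (ι := t) (t := fun _ => tr '' G) fun _ => htr) ?_) hΦ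
  rintro _ ⟨g, hg, rfl⟩ x
  exact ⟨g * x, G.mul_mem hg (ht x.2), rfl⟩

/-! ### Matrix coefficients in the convolution algebra -/

section Coefficients

variable {m : ℕ}

/-- The functional `φ` is applied to the orbit of the vector `v` under the products of `T`. -/
noncomputable def coef {V : Type*} [AddCommGroup V] [Module ℂ V] (T : Fin m → End ℂ V)
    (φ : Dual ℂ V) (v : V) : ConvAlg m :=
  fun u => φ ((u.map T).prod v)

/-- The indicator function of a one-letter word. -/
noncomputable def letter (a : Fin m) : ConvAlg m := fun w => if w = [a] then 1 else 0

theorem convAlg_add_apply (f g : ConvAlg m) (u : List (Fin m)) : (f + g) u = f u + g u := rfl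

theorem convAlg_sum_apply {ι : Type*} (s : Finset ι) (f : ι → ConvAlg m) (u : List (Fin m)) :
    (∑ i ∈ s, f i) u = ∑ i ∈ s, f i u :=
  Finset.sum_apply (M := fun _ : List (Fin m) => ℂ) u s f

theorem convAlg_mul_nil (f g : ConvAlg m) : (f * g) [] = f [] * g [] := conv_nil f g

/-- The sequence `w ↦ f(aw)`, as an element of the convolution algebra. -/
def letterShift (f : ConvAlg m) (a : Fin m) : ConvAlg m := shift f [a]

theorem convAlg_mul_cons (f g : ConvAlg m) (a : Fin m) (w : List (Fin m)) :
    (f * g) (a :: w) = (letterShift f a * g) w + f [] * g (a :: w) :=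
  conv_cons f g a w

theorem mem_R₀_of_finite {f : ConvAlg m} (h : (Set.range f).Finite)
    (h' : (Set.range (shift f)).Finite) : f ∈ R₀ m :=
  Algebra.subset_adjoin ⟨Submodule.fg_span h', h⟩

theorem shift_letter (a b : Fin m) :
    letterShift (letter a) b = if b = a then (1 : ConvAlg m) else 0 := by
  funext w
  split_ifs with h
  · subst h
    change (if [b] ++ w = [b] then (1 : ℂ) else 0) = if w = [] then 1 else 0
    simp
  · change (if [b] ++ w = [a] then (1 : ℂ) else 0) = 0
    simp [h]

theorem letter_mem_R₀ (a : Fin m) : letter a ∈ R₀ m := by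
  refine mem_R₀_of_finite ((Set.toFinite {0, 1}).subset ?_)
    ((Set.toFinite {letter a, (1 : ConvAlg m), 0}).subset ?_)
  · rintro _ ⟨u, rfl⟩
    unfold letter
    split_ifs <;> simp
  · rintro _ ⟨u, rfl⟩
    have h1 : ∀ (b : Fin m) (u : List (Fin m)) (f : ConvAlg m),
        shift f (b :: u) = shift (letterShift f b) u := fun b u f => by
      funext w
      simp [letterShift, shift]
    cases u with
    | nil => left; rfl
    | cons b u =>
      right
      rw [h1, shift_letter]
      split_ifs
      · cases u with
        | nil => left; rfl
        | cons c u =>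
          right
          funext w
          change (if c :: u ++ w = [] then (1 : ℂ) else 0) = 0
          simp
      · right
        rfl

/-- Convolution by `letter a` consumes a leading a. It encodes the letter at which a word passes
from one diagonal block to the other. -/
theorem letter_mul_cons (a b : Fin m) (f : ConvAlg m) (w : List (Fin m)) :
    (letter a * f) (b :: w) = if b = a then f w else 0 := by
  rw [convAlg_mul_cons, shift_letter]
  split_ifs with h
  · simp [letter]
  · simp only [zero_mul, letter, List.ne_cons_self, if_false, add_zero]
    rfl

theorem letter_mul_nil (a : Fin m) (f : ConvAlg m) : (letter a * f) [] = 0 := by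
  simp [convAlg_mul_nil, letter]

section

variable {V : Type*} [AddCommGroup V] [Module ℂ V] (T : Fin m → End ℂ V)

theorem coef_cons (φ : Dual ℂ V) (v : V) (a : Fin m) (w : List (Fin m)) :
    coef T φ v (a :: w) = coef T (φ ∘ₗ T a) v w := by
  simp [coef]

theorem shift_coef (φ : Dual ℂ V) (v : V) (a : Fin m) :
    letterShift (coef T φ v) a = coef T (φ ∘ₗ T a) v := by
  funext w
  exact coef_cons T φ v a w

theorem coef_add_left (φ ψ : Dual ℂ V) (v : V) :
    coef T (φ + ψ) v = coef T φ v + coef T ψ v := rfl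

/-- A representation with finite image has its coefficients in `𝓡₀`. -/
theorem coef_mem_R₀_of_finite
    (h : (Set.range fun u : List (Fin m) => (u.map T).prod).Finite) (φ : Dual ℂ V) (v : V) :
    coef T φ v ∈ R₀ m := by
  refine mem_R₀_of_finite ?_ ?_
  · refine (h.image fun g : End ℂ V => φ (g v)).subset ?_
    rintro _ ⟨u, rfl⟩
    exact ⟨_, ⟨u, rfl⟩, rfl⟩
  · refine (h.image fun g : End ℂ V => (coef T (φ ∘ₗ g) v : List (Fin m) → ℂ)).subset ?_
    rintro _ ⟨u, rfl⟩
    refine ⟨_, ⟨u, rfl⟩, ?_⟩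
    funext w
    simp [shift, coef]

/-- If the coefficients of the restriction to an invariant subspace `W` and of the quotient by `W`
are in `𝓡₀`, so are all coefficients.  Here `E` is a projection onto `W`. -/
theorem coef_mem_R₀_of_invariant [FiniteDimensional ℂ V] (W : Submodule ℂ V)
    (hW : ∀ a, ∀ w ∈ W, T a w ∈ W)
    (hsub : ∀ φ : Dual ℂ V, ∀ v ∈ W, coef T φ v ∈ R₀ m)
    (hquot : ∀ φ : Dual ℂ V, (∀ w ∈ W, φ w = 0) → ∀ v, coef T φ v ∈ R₀ m)
    (φ : Dual ℂ V) (v : V) : coef T φ v ∈ R₀ m := by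
  obtain ⟨p, hp⟩ := W.subtype.exists_leftInverse_of_injective W.ker_subtype
  have hpw : ∀ w : W, p w = w := fun w => congr($hp w)
  set E : End ℂ V := W.subtype ∘ₗ p with hE
  have hEW : ∀ x, E x ∈ W := fun x => (p x).2
  have hEid : ∀ x ∈ W, E x = x := fun x hx => congrArg Subtype.val (hpw ⟨x, hx⟩)
  have hTE : ∀ a x, E (T a (E x)) = T a (E x) := fun a x => hEid _ (hW a _ (hEW x))
  have hvan : ∀ ψ : Dual ℂ V, ∀ w ∈ W, (ψ - ψ ∘ₗ E) w = 0 := fun ψ w hw => by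
    simp [hEid w hw]
  let b := Module.finBasis ℂ W
  -- On a word aw, g k is the k-th coordinate in W of T_a (1 - E) T_w v. The functionals used vanish
  -- on W, so they come from the quotient.
  let g (k) : ConvAlg m :=
    ∑ a, letter a * coef T ((b.coord k ∘ₗ p ∘ₗ T a) - (b.coord k ∘ₗ p ∘ₗ T a) ∘ₗ E) v
  have hg0 : ∀ k, g k [] = 0 := fun k => by
    simp [g, convAlg_sum_apply, letter_mul_nil]
  have hg1 : ∀ k a w, g k (a :: w) =
      b.coord k (p (T a ((w.map T).prod v - E ((w.map T).prod v)))) := fun k a w => by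
    simp [g, convAlg_sum_apply, letter_mul_cons, coef]
  have hgR : ∀ k, g k ∈ R₀ m := fun k =>
    Subalgebra.sum_mem _ fun a _ => Subalgebra.mul_mem _ (letter_mem_R₀ a) (hquot _ (hvan _) v)
  -- Iterating E T_a = T_a E + E T_a (1 - E) gives E T_w = T_w E + ∑ T_x E T_a (1 - E) T_y over the
  -- factorizations w = xay.
  have hsplit : ∀ (w : List (Fin m)) (ψ : Dual ℂ V),
      coef T (ψ ∘ₗ E) v w =
        coef T ψ (E v) w + ∑ k, (coef T ψ (b k) * g k) w := by
    intro w
    induction w with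
    | nil =>
      intro ψ
      simp [coef, convAlg_mul_nil, hg0]
    | cons a w ih =>
      intro ψ
      have hb : ∀ x : V, ∑ k, ψ (b k) * b.coord k (p x) = ψ (E x) := fun x => by
        have h := congrArg (ψ ∘ₗ W.subtype) (b.sum_repr (p x))
        rw [map_sum] at h
        simpa [hE, mul_comm] using h
      have h1 := ih (ψ ∘ₗ T a)
      have h2 : ∀ k, (coef T ψ (b k) * g k) (a :: w) =
          (coef T (ψ ∘ₗ T a) (b k) * g k) w + ψ (b k) *
            b.coord k (p (T a ((w.map T).prod v - E ((w.map T).prod v)))) := fun k => by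
        rw [convAlg_mul_cons, shift_coef, hg1]
        simp [coef]
      simp only [h2, Finset.sum_add_distrib, hb, coef_cons]
      rw [← add_assoc, ← h1]
      simp [coef, hTE]
  have key : coef T (φ ∘ₗ E) v = coef T φ (E v) + ∑ k, coef T φ (b k) * g k := by
    funext w
    rw [hsplit w φ, convAlg_add_apply, convAlg_sum_apply]
  have : φ = φ ∘ₗ E + (φ - φ ∘ₗ E) := by abel
  rw [this, coef_add_left, key]
  exact add_mem (add_mem (hsub _ _ (hEW v)) (sum_mem fun k _ =>
    mul_mem (hsub _ _ (b k).2) (hgR k))) (hquot _ (hvan φ) v)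

end

theorem prod_map_mem_closure {M : Type*} [Monoid M] (A : Fin m → M) (u : List (Fin m)) :
    (u.map A).prod ∈ Submonoid.closure (Set.range A) :=
  Submonoid.list_prod_mem _ fun x hx => by
    obtain ⟨a, _, rfl⟩ := List.mem_map.1 hx
    exact Submonoid.subset_closure ⟨a, rfl⟩

theorem exists_prod_map_of_mem_closure {M : Type*} [Monoid M] (A : Fin m → M) {B : M}
    (hB : B ∈ Submonoid.closure (Set.range A)) : ∃ u : List (Fin m), (u.map A).prod = B := by
  induction hB using Submonoid.closure_induction with
  | mem x hx => obtain ⟨a, rfl⟩ := hx; exact ⟨[a], by simp⟩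
  | one => exact ⟨[], rfl⟩
  | mul x y _ _ hx hy =>
    obtain ⟨u, rfl⟩ := hx
    obtain ⟨w, rfl⟩ := hy
    exact ⟨u ++ w, by simp⟩

section Intertwine

variable {V V' : Type*} [AddCommGroup V] [Module ℂ V] [AddCommGroup V'] [Module ℂ V']
  (L : V →ₗ[ℂ] V')

theorem prod_map_intertwine {T : Fin m → End ℂ V} {T' : Fin m → End ℂ V'}
    (h : ∀ a x, T' a (L x) = L (T a x)) (u : List (Fin m)) (x : V) :
    (u.map T').prod (L x) = L ((u.map T).prod x) := by
  induction u with
  | nil => rfl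
  | cons a u ih => simp [ih, h]

theorem aeval_intertwine {g : End ℂ V} {g' : End ℂ V'} (h : ∀ x, g' (L x) = L (g x))
    (Q : ℂ[X]) (x : V) : aeval g' Q (L x) = L (aeval g Q x) := by
  induction Q using Polynomial.induction_on generalizing x with
  | C a => simp [Module.algebraMap_end_apply]
  | add p q hp hq => simp [hp, hq]
  | monomial k a hk =>
    have e : C a * X ^ (k + 1) = C a * X ^ k * (X : ℂ[X]) := by ring
    rw [e, map_mul (aeval g'), map_mul (aeval g), aeval_X, aeval_X, End.mul_apply, End.mul_apply,
      ← hk, h]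

end Intertwine

/-- The coefficients of a representation of the free monoid, all of whose operators are killed by
one nonzero polynomial, are in `𝓡₀`. -/
theorem coef_mem_R₀ {P : ℂ[X]} (hP : P ≠ 0) (n : ℕ) (V : Type) [AddCommGroup V] [Module ℂ V]
    [FiniteDimensional ℂ V] (hn : finrank ℂ V = n) (T : Fin m → End ℂ V)
    (hT : ∀ u : List (Fin m), aeval (u.map T).prod P = 0) (φ : Dual ℂ V) (v : V) :
    coef T φ v ∈ R₀ m := by
  induction n using Nat.strong_induction_on generalizing V with
  | _ n ih =>
  by_cases hirr : ∀ W : Submodule ℂ V, (∀ a ∈ Set.range T, ∀ w ∈ W, a w ∈ W) → W = ⊥ ∨ W = ⊤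
  · refine coef_mem_R₀_of_finite T ?_ φ v
    rcases subsingleton_or_nontrivial V with hV | hV
    · exact Set.toFinite _
    have hspan := adjoin_eq_top_of_irreducible (Set.range T) hirr
    rw [← Algebra.toSubmodule_eq_top, Algebra.adjoin_eq_span] at hspan
    refine (finite_of_span_eq_top _ hspan hP ?_).subset ?_
    · intro g hg
      obtain ⟨u, rfl⟩ := exists_prod_map_of_mem_closure T hg
      exact hT u
    · rintro _ ⟨u, rfl⟩
      exact prod_map_mem_closure T u
  · push Not at hirr
    -- W and V/W both have smaller dimension, and P still annihilates the induced operators.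
    obtain ⟨W, hW', hbot, htop⟩ := hirr
    have hW : ∀ a, ∀ w ∈ W, T a w ∈ W := fun a => hW' _ ⟨a, rfl⟩
    refine coef_mem_R₀_of_invariant T W hW ?_ ?_ φ v
    · intro φ v hv
      let T' : Fin m → End ℂ W := fun a => (T a).restrict (hW a)
      have hT' := prod_map_intertwine (T := T') (T' := T) W.subtype fun _ _ => rfl
      have := ih (finrank ℂ W) (hn ▸ Submodule.finrank_lt htop) W rfl T' (fun u => by
        refine LinearMap.ext fun w => W.injective_subtype ?_
        rw [← aeval_intertwine W.subtype (hT' u), hT u]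
        simp) (φ ∘ₗ W.subtype) ⟨v, hv⟩
      convert this using 1
      funext u
      exact congrArg φ (hT' u ⟨v, hv⟩)
    · intro φ hφ v
      let T' : Fin m → End ℂ (V ⧸ W) := fun a => W.mapQ W (T a) (hW a)
      have hT' := prod_map_intertwine (T := T) (T' := T') W.mkQ fun _ _ => rfl
      have hlt : finrank ℂ (V ⧸ W) < n := by
        have h1 := W.finrank_quotient_add_finrank
        have h2 := Submodule.one_le_finrank_iff.2 hbot
        omega
      have := ih _ hlt (V ⧸ W) rfl T' (fun u => by
        refine LinearMap.ext fun x => ?_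
        obtain ⟨w, rfl⟩ := W.mkQ_surjective x
        rw [aeval_intertwine W.mkQ (hT' u), hT u]
        simp) (W.liftQ φ fun w hw => hφ w hw) (W.mkQ v)
      convert this using 1
      funext u
      exact congrArg (W.liftQ φ fun w hw => hφ w hw) (hT' u v).symm

end Coefficients

/-! ### Minimal integer representations -/

section Translates

variable {m : ℕ}

/-- The complex span of the two-sided translates `u ↦ f(xuy)`. -/
def translates (f : List (Fin m) → ℂ) : Submodule ℂ (List (Fin m) → ℂ) :=
  Submodule.span ℂ (Set.range fun p : List (Fin m) × List (Fin m) => fun u => f (p.1 ++ u ++ p.2))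

/-- A regular integer sequence has an integer linear representation whose matrix entries are
combinations of translates of the sequence. -/
theorem IsRegular.exists_rep {f : List (Fin m) → ℤ} (hf : IsRegular ℤ f) :
    ∃ (d : ℕ) (A : Fin m → Matrix (Fin d) (Fin d) ℤ) (v w : Fin d → ℤ),
      (∀ u : List (Fin m), f u = w ⬝ᵥ (u.map A).prod.mulVec v) ∧
      ∀ i j, (fun u : List (Fin m) => (((u.map A).prod i j : ℤ) : ℂ)) ∈
        translates (toComplex f) := by
  classical
  set M := Submodule.span ℤ (Set.range (shift f))
  have : Module.Finite ℤ M := Module.Finite.iff_fg.2 hf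
  -- M is finitely generated and torsion-free over a principal ideal domain.
  have : Module.Free ℤ M := inferInstance
  let b := Module.finBasis ℤ M
  have hshift : ∀ g ∈ M, ∀ a, shift g [a] ∈ M := by
    intro g hg a
    induction hg using Submodule.span_induction with
    | mem g hg =>
      obtain ⟨u, rfl⟩ := hg
      refine Submodule.subset_span ⟨u ++ [a], ?_⟩
      funext w
      simp [shift]
    | zero => exact M.zero_mem
    | add g h _ _ hg hh => exact M.add_mem hg hh
    | smul c g _ hg => exact M.smul_mem c hg
  have hexp : ∀ (g : M) (u : List (Fin m)), g.1 u = ∑ i, b.repr g i * (b i).1 u := fun g u => by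
    refine (congrArg (fun h : M => h.1 u) (b.sum_repr g)).symm.trans ?_
    simp only [Submodule.coe_sum, Finset.sum_apply, Submodule.coe_smul, Pi.smul_apply, smul_eq_mul]
  let A : Fin m → Matrix (Fin (finrank ℤ M)) (Fin (finrank ℤ M)) ℤ := fun a i j =>
    b.repr ⟨shift (b i).1 [a], hshift _ (b i).2 a⟩ j
  have hA : ∀ (u w : List (Fin m)) i, (b i).1 (u ++ w) =
      ∑ j, (u.map A).prod i j * (b j).1 w := by
    intro u w
    induction u with
    | nil => intro i; simp [Matrix.one_apply]
    | cons a u ih =>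
      intro i
      have h1 : (b i).1 (a :: u ++ w) = ∑ j, A a i j * (b j).1 (u ++ w) :=
        hexp ⟨shift (b i).1 [a], hshift _ (b i).2 a⟩ (u ++ w)
      simp only [h1, ih, List.map_cons, List.prod_cons, Matrix.mul_apply, Finset.mul_sum,
        Finset.sum_mul, mul_assoc]
      exact Finset.sum_comm
  have hfM : f ∈ M := Submodule.subset_span ⟨[], rfl⟩
  refine ⟨finrank ℤ M, A, fun j => (b j).1 [], fun i => b.repr ⟨f, hfM⟩ i, fun u => ?_,
    fun i j => ?_⟩
  · refine (hexp ⟨f, hfM⟩ u).trans (Finset.sum_congr rfl fun i _ => ?_)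
    have := hA u [] i
    rw [List.append_nil] at this
    rw [this]
    rfl
  let r : List (Fin m) → Fin (finrank ℤ M) → ℚ := fun y i => ((b i).1 y : ℚ)
  have hli : LinearIndependent ℚ fun i => (fun y => ((b i).1 y : ℚ)) := by
    rw [← LinearIndependent.iff_fractionRing (R := ℤ) (K := ℚ), Fintype.linearIndependent_iff]
    intro c hc
    refine Fintype.linearIndependent_iff.1 b.linearIndependent c (Subtype.ext (funext fun y => ?_))
    have := congrFun hc y
    simp only [Finset.sum_apply, zsmul_eq_mul, Pi.mul_apply, Pi.intCast_apply,
      Pi.zero_apply] at this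
    simp only [Submodule.coe_sum, Finset.sum_apply, Submodule.coe_smul, Pi.smul_apply, smul_eq_mul,
      Submodule.coe_zero, Pi.zero_apply]
    exact_mod_cast this
  -- A functional vanishing on every evaluation vector r y would be a linear relation among the
  -- basis functions.
  have hr : Submodule.span ℚ (Set.range r) = ⊤ := by
    by_contra hne
    obtain ⟨φ, hφ, hle⟩ := Submodule.exists_le_ker_of_lt_top _ (lt_top_iff_ne_top.2 hne)
    apply hφ
    have h0 := Fintype.linearIndependent_iff.1 hli (fun i => φ (Pi.single i 1)) (by
      funext y
      have hy : φ (r y) = 0 := hle (Submodule.subset_span ⟨y, rfl⟩)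
      rw [LinearMap.pi_apply_eq_sum_univ φ (r y)] at hy
      have hs : ∀ i : Fin (finrank ℤ M), (fun j => if i = j then (1 : ℚ) else 0) = Pi.single i 1 := fun i => by
        funext j
        simp [Pi.single_apply, eq_comm]
      simpa [r, hs, mul_comm, Finset.sum_apply] using hy)
    refine LinearMap.pi_ext' fun i => LinearMap.ext_ring ?_
    simpa using h0 i
  have hb : ∀ (y : List (Fin m)) (g) (_ : g ∈ M), (fun u => ((g (u ++ y) : ℤ) : ℂ)) ∈
      translates (toComplex f) := by
    intro y g hg
    induction hg using Submodule.span_induction with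
    | mem g hg =>
      obtain ⟨x, rfl⟩ := hg
      refine Submodule.subset_span ⟨(x, y), ?_⟩
      funext u
      simp [shift, toComplex]
    | zero =>
      convert Submodule.zero_mem (translates (toComplex f)) using 1
      funext u
      simp
    | add g h _ _ hg hh => simpa using! Submodule.add_mem _ hg hh
    | smul c g _ hg => simpa using! Submodule.smul_mem _ (c : ℂ) hg
  -- Writing the unit vector e_j as a combination of evaluation vectors turns the (i, j) entry of
  -- A_u into the same combination of the values b_i(uy).
  obtain ⟨q, hq⟩ := (Finsupp.mem_span_range_iff_exists_finsupp (R := ℚ) (v := r)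
    (x := Pi.single j 1)).1 (hr ▸ Submodule.mem_top)
  have hent : (fun u : List (Fin m) => (((u.map A).prod i j : ℤ) : ℂ)) =
      ∑ y ∈ q.support, ((q y : ℚ) : ℂ) • fun u => (((b i).1 (u ++ y) : ℤ) : ℂ) := by
    funext u
    have hQ : (((u.map A).prod i j : ℤ) : ℚ) = ∑ y ∈ q.support, q y * ((b i).1 (u ++ y) : ℤ) := by
      have h1 : ∀ l, (Pi.single j 1 : Fin (finrank ℤ M) → ℚ) l =
          ∑ y ∈ q.support, q y * ((b l).1 y : ℚ) := fun l => by
        rw [← hq]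
        simp [Finsupp.sum, r, Finset.sum_apply]
      calc (((u.map A).prod i j : ℤ) : ℚ)
          = ∑ l, ((u.map A).prod i l : ℚ) * (Pi.single j 1 : Fin (finrank ℤ M) → ℚ) l := by
            simp [Pi.single_apply]
        _ = _ := by
            simp only [h1, hA, Finset.mul_sum]
            rw [Finset.sum_comm]
            push_cast
            simp only [Finset.mul_sum]
            exact Finset.sum_congr rfl fun y _ => Finset.sum_congr rfl fun l _ => by ring
    have := congrArg (fun x : ℚ => (x : ℂ)) hQ
    simpa [Finset.sum_apply] using this
  rw [hent]
  exact Submodule.sum_mem _ fun y _ => Submodule.smul_mem _ _ (hb y _ (b i).2)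

end Translates

/-! ### Polynomial growth -/

section Growth

variable {m : ℕ}

/-- The base 1 + |u| ≥ 1 covers the empty word and lets exponents be raised freely. -/
theorem isPolyBounded_iff {f : List (Fin m) → ℂ} : IsPolyBounded f ↔
    ∃ k : ℕ, ∃ C : ℝ, 0 ≤ C ∧ ∀ u, ‖f u‖ ≤ C * (1 + (u.length : ℝ)) ^ k := by
  constructor
  · rintro ⟨k, hk, c, hc, h⟩
    refine ⟨⌈k⌉₊, c + ‖f []‖, by positivity, fun u => ?_⟩
    have h1 : (1 : ℝ) ≤ 1 + (u.length : ℝ) := by simp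
    by_cases hu : u = []
    · subst hu
      simp [hc.le]
    · calc ‖f u‖ ≤ c * (u.length : ℝ) ^ k := h u hu
        _ ≤ c * (1 + (u.length : ℝ)) ^ k := by gcongr; linarith
        _ ≤ c * (1 + (u.length : ℝ)) ^ (⌈k⌉₊ : ℝ) := by
            gcongr
            exact Nat.le_ceil k
        _ ≤ _ := by
            rw [Real.rpow_natCast]
            gcongr
            linarith [norm_nonneg (f [])]
  · rintro ⟨k, C, hC, h⟩
    refine ⟨k, by positivity, (C + 1) * 2 ^ k, by positivity, fun u hu => ?_⟩
    have h1 : (1 : ℝ) ≤ u.length := by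
      exact_mod_cast List.length_pos_iff.2 hu
    calc ‖f u‖ ≤ C * (1 + (u.length : ℝ)) ^ k := h u
      _ ≤ (C + 1) * (2 * (u.length : ℝ)) ^ k := by gcongr <;> linarith
      _ = _ := by rw [mul_pow, Real.rpow_natCast]; ring

theorem IsPolyBounded.add {f g : List (Fin m) → ℂ} (hf : IsPolyBounded f) (hg : IsPolyBounded g) :
    IsPolyBounded (f + g) := by
  rw [isPolyBounded_iff] at *
  obtain ⟨k, C, hC, hf⟩ := hf
  obtain ⟨l, D, hD, hg⟩ := hg
  refine ⟨k + l, C + D, by positivity, fun u => ?_⟩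
  have h1 : (1 : ℝ) ≤ 1 + (u.length : ℝ) := by simp
  calc ‖f u + g u‖ ≤ C * (1 + (u.length : ℝ)) ^ k + D * (1 + (u.length : ℝ)) ^ l :=
        (norm_add_le _ _).trans (add_le_add (hf u) (hg u))
    _ ≤ C * (1 + (u.length : ℝ)) ^ (k + l) + D * (1 + (u.length : ℝ)) ^ (k + l) := by
        gcongr <;> first | exact h1 | simp
    _ = _ := by ring

theorem IsPolyBounded.of_finite {f : List (Fin m) → ℂ} (hf : (Set.range f).Finite) :
    IsPolyBounded f := by
  rw [isPolyBounded_iff]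
  obtain ⟨C, hC⟩ := hf.isBounded.exists_norm_le
  refine ⟨0, C, (norm_nonneg _).trans (hC (f []) ⟨[], rfl⟩), fun u => ?_⟩
  simpa using hC _ ⟨u, rfl⟩

theorem IsPolyBounded.conv {f g : List (Fin m) → ℂ} (hf : IsPolyBounded f)
    (hg : IsPolyBounded g) : IsPolyBounded (conv f g) := by
  rw [isPolyBounded_iff] at *
  obtain ⟨k, C, hC, hf⟩ := hf
  obtain ⟨l, D, hD, hg⟩ := hg
  refine ⟨k + l + 1, C * D, by positivity, fun u => ?_⟩
  calc ‖RegularSeq.conv f g u‖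
      ≤ ∑ j ∈ Finset.range (u.length + 1), ‖f (u.take j) * g (u.drop j)‖ := norm_sum_le _ _
    _ ≤ ∑ j ∈ Finset.range (u.length + 1),
        (C * (1 + (u.length : ℝ)) ^ k) * (D * (1 + (u.length : ℝ)) ^ l) := by
        refine Finset.sum_le_sum fun j _ => ?_
        rw [norm_mul]
        refine mul_le_mul ((hf _).trans ?_) ((hg _).trans ?_) (norm_nonneg _) (by positivity)
        · gcongr
          simp
        · gcongr
          simp
    _ = _ := by
        rw [Finset.sum_const, Finset.card_range, nsmul_eq_mul]
        push_cast
        ring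

theorem IsPolyBounded.smul {f : List (Fin m) → ℂ} (hf : IsPolyBounded f) (c : ℂ) :
    IsPolyBounded (c • f) := by
  rw [isPolyBounded_iff] at *
  obtain ⟨k, C, hC, hf⟩ := hf
  refine ⟨k, ‖c‖ * C, by positivity, fun u => ?_⟩
  rw [Pi.smul_apply, norm_smul, mul_assoc]
  gcongr
  exact hf u

theorem isPolyBounded_of_mem_R₀ {f : ConvAlg m} (hf : f ∈ R₀ m) : IsPolyBounded (m := m) f := by
  induction hf using Algebra.adjoin_induction with
  | mem f hf => exact IsPolyBounded.of_finite hf.2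
  | algebraMap c =>
    rw [Algebra.algebraMap_eq_smul_one]
    refine IsPolyBounded.smul (f := convOne m) (IsPolyBounded.of_finite ?_) c
    refine (Set.toFinite {0, 1}).subset ?_
    rintro _ ⟨u, rfl⟩
    unfold convOne
    split_ifs <;> simp
  | add f g _ _ hf hg => exact hf.add hg
  | mul f g _ _ hf hg => exact hf.conv hg

theorem isPolyBounded_of_mem_translates {f g : List (Fin m) → ℂ} (hf : IsPolyBounded f)
    (hg : g ∈ translates f) : IsPolyBounded g := by
  induction hg using Submodule.span_induction with
  | mem g hg =>
    obtain ⟨⟨x, y⟩, rfl⟩ := hg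
    rw [isPolyBounded_iff] at *
    obtain ⟨k, C, hC, hf⟩ := hf
    refine ⟨k, C * (1 + x.length + y.length) ^ k, by positivity, fun u => (hf _).trans ?_⟩
    rw [mul_assoc, ← mul_pow]
    gcongr
    simp only [List.length_append]
    push_cast
    have : (0 : ℝ) ≤ (x.length + y.length) * u.length := by positivity
    linarith
  | zero => exact IsPolyBounded.of_finite ((Set.toFinite {0}).subset (by rintro _ ⟨u, rfl⟩; simp))
  | add g h _ _ hg hh => exact hg.add hh
  | smul c g _ hg => exact hg.smul c

/-- The length of u^n is linear in n, so |z|^n grows at most polynomially in n. -/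
theorem norm_le_one_of_isPolyBounded {g : List (Fin m) → ℂ} (hg : IsPolyBounded g)
    (u : List (Fin m)) {z : ℂ} (hz : ∀ n, g (List.replicate n u).flatten = z ^ n) : ‖z‖ ≤ 1 := by
  rw [isPolyBounded_iff] at hg
  obtain ⟨k, C, hC, hg⟩ := hg
  by_contra! hlt
  have h1 := (tendsto_pow_const_div_const_pow_of_one_lt k hlt).comp (Filter.tendsto_add_atTop_nat 1)
  -- The constant comes from 1 + n|u| ≤ (1 + |u|)(n + 1); the factor ‖z‖ offsets the shift from n to
  -- n + 1.
  have h2 := h1.const_mul (C * (1 + u.length) ^ k * ‖z‖)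
  rw [mul_zero] at h2
  obtain ⟨n, hn⟩ := (h2.eventually (gt_mem_nhds one_pos)).exists
  have hzn : 0 < ‖z‖ ^ n := by positivity
  have h3 : ‖z‖ ^ n ≤ C * (1 + u.length) ^ k * ((n + 1 : ℕ) : ℝ) ^ k := by
    rw [← norm_pow, ← hz n, mul_assoc, ← mul_pow]
    refine (hg _).trans ?_
    gcongr
    simp only [List.length_flatten, List.map_replicate, List.sum_replicate, smul_eq_mul]
    push_cast
    have : (0 : ℝ) ≤ n + u.length := by positivity
    linarith
  have h4 : C * (1 + u.length) ^ k * ‖z‖ * (((n + 1 : ℕ) : ℝ) ^ k / ‖z‖ ^ (n + 1)) =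
      C * (1 + u.length) ^ k * ((n + 1 : ℕ) : ℝ) ^ k / ‖z‖ ^ n := by
    have : ‖z‖ ≠ 0 := by positivity
    rw [pow_succ ‖z‖ n]
    field_simp
  simp only [Function.comp_apply] at hn
  rw [h4, div_lt_one hzn] at hn
  linarith

end Growth

/-! ### Eigenvalues and common annihilators -/

section IntegerRep

variable {m d : ℕ}

/-- An integer matrix, regarded as a complex one. -/
def complexify (A : Matrix (Fin d) (Fin d) ℤ) : Matrix (Fin d) (Fin d) ℂ :=
  (Int.castRingHom ℂ).mapMatrix A

theorem prod_map_complexify (A : Fin m → Matrix (Fin d) (Fin d) ℤ) (u : List (Fin m)) :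
    (u.map fun a => complexify (A a)).prod = complexify (u.map A).prod := by
  simp [complexify, map_list_prod, Function.comp_def]

theorem prod_map_replicate {M : Type*} [Monoid M] (A : Fin m → M) (u : List (Fin m)) (n : ℕ) :
    ((List.replicate n u).flatten.map A).prod = (u.map A).prod ^ n := by
  simp [List.map_flatten, List.prod_flatten]

/-- Powers of an eigenvalue are values of combinations of matrix entries. -/
theorem exists_mem_eq_pow_of_hasEigenvalue {A : Fin m → Matrix (Fin d) (Fin d) ℤ}
    {S : Submodule ℂ (List (Fin m) → ℂ)}
    (hA : ∀ i j, (fun u : List (Fin m) => (((u.map A).prod i j : ℤ) : ℂ)) ∈ S)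
    (u : List (Fin m)) {z : ℂ}
    (hz : End.HasEigenvalue (Matrix.toLin' (complexify (u.map A).prod)) z) :
    ∃ g ∈ S, ∀ n, g (List.replicate n u).flatten = z ^ n := by
  obtain ⟨x, hx⟩ := hz.exists_hasEigenvector
  obtain ⟨i, hi⟩ := Function.ne_iff.1 hx.2
  rw [Pi.zero_apply] at hi
  -- This is row i of the eigenvector equation A_u^n x = z^n x, divided by x_i ≠ 0.
  refine ⟨(x i)⁻¹ • ∑ j, x j • fun u : List (Fin m) => (((u.map A).prod i j : ℤ) : ℂ),
    S.smul_mem _ (S.sum_mem fun j _ => S.smul_mem _ (hA i j)), fun n => ?_⟩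
  have h1 : (Matrix.toLin' (complexify (u.map A).prod) ^ n) x = z ^ n • x := hx.pow_apply n
  rw [← Matrix.toLin'_pow] at h1
  have h2 := congrFun h1 i
  rw [Matrix.toLin'_apply, complexify, ← map_pow, ← prod_map_replicate] at h2
  simp only [Matrix.mulVec, dotProduct, RingHom.mapMatrix_apply, Matrix.map_apply, Pi.smul_apply,
    smul_eq_mul, eq_intCast] at h2
  simp only [Pi.smul_apply, Finset.sum_apply, smul_eq_mul]
  rw [inv_mul_eq_iff_eq_mul₀ hi, mul_comm (x i), ← h2]
  exact Finset.sum_congr rfl fun j _ => mul_comm _ _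

/-- Combinations of translates of a sequence with a linear representation `B` are linear
functionals of `B`. -/
theorem exists_linear_of_mem_translates {f g : List (Fin m) → ℂ}
    {B : Fin m → Matrix (Fin d) (Fin d) ℂ} {v w : Fin d → ℂ}
    (hf : ∀ u, f u = w ⬝ᵥ (wordProd B u).mulVec v) (hg : g ∈ translates f) :
    ∃ L : Matrix (Fin d) (Fin d) ℂ →ₗ[ℂ] ℂ, ∀ u, g u = L (wordProd B u) := by
  induction hg using Submodule.span_induction with
  | mem g hg =>
    obtain ⟨⟨x, y⟩, rfl⟩ := hg
    refine ⟨{ toFun := fun X => w ⬝ᵥ (wordProd B x * X * wordProd B y).mulVec v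
              map_add' := fun X Y => by
                rw [mul_add, add_mul, Matrix.add_mulVec, dotProduct_add]
              map_smul' := fun c X => by
                simp [Matrix.smul_mulVec] }, fun u => ?_⟩
    simp [hf, wordProd, mul_assoc]
  | zero => exact ⟨0, fun _ => rfl⟩
  | add g h _ _ hg hh =>
    obtain ⟨L, hL⟩ := hg
    obtain ⟨L', hL'⟩ := hh
    exact ⟨L + L', fun u => by simp [hL, hL']⟩
  | smul c g _ hg =>
    obtain ⟨L, hL⟩ := hg
    exact ⟨c • L, fun u => by simp [hL]⟩

/-- The functional p ↦ L(p(B_u)) agrees with evaluation at z on monomials, hence everywhere. By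
Cayley–Hamilton z is then an eigenvalue of B_u, so it is 0 or a root of unity. -/
theorem norm_le_one_of_mem_S₀ {f g : List (Fin m) → ℂ} (hf : f ∈ S₀ m) (hg : g ∈ translates f)
    (u : List (Fin m)) {z : ℂ} (hz : ∀ n, g (List.replicate n u).flatten = z ^ n) : ‖z‖ ≤ 1 := by
  obtain ⟨d, _, B, v, w, hB, hf⟩ := hf
  obtain ⟨L, hL⟩ := exists_linear_of_mem_translates hf hg
  have hLp : ∀ p : ℂ[X], L (aeval (wordProd B u) p) = p.eval z := fun p => by
    induction p using Polynomial.induction_on' with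
    | add p q hp hq => simp [hp, hq]
    | monomial n a =>
      rw [aeval_monomial, ← Algebra.smul_def, map_smul, wordProd, ← prod_map_replicate, ← wordProd,
        ← hL, hz, eval_monomial, smul_eq_mul]
  have hroot : (wordProd B u).charpoly.IsRoot z := by
    have := hLp (wordProd B u).charpoly
    rw [Matrix.aeval_self_charpoly, map_zero] at this
    exact this.symm
  have hev : End.HasEigenvalue (Matrix.toLin' (wordProd B u)) z := by
    rw [End.hasEigenvalue_iff_isRoot_charpoly, Matrix.charpoly_toLin']
    exact hroot
  rcases hB _ (prod_map_mem_closure B u) z hev with rfl | ⟨n, hn, h1⟩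
  · simp
  · exact (Complex.norm_eq_one_of_pow_eq_one h1 hn.ne').le

/-- Integer matrices whose eigenvalues all lie in the closed unit disc are killed by a common
polynomial. -/
theorem exists_common_annihilator (d : ℕ) : ∃ P : ℂ[X], P ≠ 0 ∧
    ∀ A : Matrix (Fin d) (Fin d) ℤ,
      (∀ z, End.HasEigenvalue (Matrix.toLin' (complexify A)) z → ‖z‖ ≤ 1) →
        aeval (Matrix.toLin' (complexify A)) P = 0 := by
  classical
  -- Northcott finiteness: a monic polynomial with all roots in the closed unit disc has Mahler
  -- measure 1.
  have hfin := (finite_mahlerMeasure_le d 1).subset (Set.sep_subset _ fun p : ℤ[X] => p.Monic)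
  refine ⟨∏ p ∈ hfin.toFinset, p.map (Int.castRingHom ℂ), ?_, fun A hA => ?_⟩
  · rw [Finset.prod_ne_zero_iff]
    intro p hp
    exact ((hfin.mem_toFinset.1 hp).2.map _).ne_zero
  · have hmap : A.charpoly.map (Int.castRingHom ℂ) = (complexify A).charpoly :=
      (Matrix.charpoly_map A (Int.castRingHom ℂ)).symm
    have hmem : A.charpoly ∈ hfin.toFinset := by
      rw [hfin.mem_toFinset]
      refine ⟨⟨?_, ?_⟩, A.charpoly_monic⟩
      · rw [Matrix.charpoly_natDegree_eq_dim, Fintype.card_fin]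
      · rw [hmap, mahlerMeasure_eq_leadingCoeff_mul_prod_roots,
          (complexify A).charpoly_monic.leadingCoeff, norm_one, one_mul]
        refine (congrArg Multiset.prod (Multiset.map_congr rfl fun z hz => ?_)).le.trans
          (b := ((complexify A).charpoly.roots.map fun _ => (1 : ℝ)).prod) (by simp)
        refine max_eq_left (hA z ?_)
        rw [End.hasEigenvalue_iff_isRoot_charpoly, Matrix.charpoly_toLin']
        exact isRoot_of_mem_roots hz
    obtain ⟨Q, hQ⟩ := Finset.dvd_prod_of_mem (fun p : ℤ[X] => p.map (Int.castRingHom ℂ)) hmem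
    rw [hQ, map_mul]
    simp only [hmap]
    rw [← Matrix.charpoly_toLin', LinearMap.aeval_self_charpoly, zero_mul]

/-- A matrix semigroup with a common annihilating polynomial is tame. -/
theorem generatesTame_of_aeval_eq_zero {P : ℂ[X]} (hP : P ≠ 0)
    {𝒜 : Set (Matrix (Fin d) (Fin d) ℂ)}
    (h : ∀ B ∈ Submonoid.closure 𝒜, aeval (Matrix.toLin' B) P = 0) : GeneratesTame 𝒜 := by
  intro B hB z hz
  obtain ⟨x, hx⟩ := hz.exists_hasEigenvector
  have hmem : ∀ n : ℕ, z ^ n ∈ P.roots.toFinset := fun n => by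
    have hv : End.HasEigenvector (Matrix.toLin' (B ^ n)) (z ^ n) x := by
      rw [End.hasEigenvector_iff, End.mem_eigenspace_iff, Matrix.toLin'_pow]
      exact ⟨hx.pow_apply n, hx.2⟩
    have := End.aeval_apply_of_hasEigenvector (p := P) hv
    rw [h _ (pow_mem hB n)] at this
    rw [Multiset.mem_toFinset, mem_roots hP]
    exact (smul_eq_zero.1 this.symm).resolve_right hx.2
  by_cases hz0 : z = 0
  · exact Or.inl hz0
  right
  -- Pigeonhole: the infinitely many exponents give only finitely many powers of z.
  obtain ⟨n, k, hnk, he⟩ := Finite.exists_ne_map_eq_of_infinite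
    fun n : ℕ => (⟨z ^ n, hmem n⟩ : P.roots.toFinset)
  replace he : z ^ n = z ^ k := congrArg Subtype.val he
  wlog hlt : n < k generalizing n k
  · exact this k n hnk.symm he.symm (lt_of_le_of_ne (not_lt.1 hlt) hnk.symm)
  refine ⟨k - n, by omega, ?_⟩
  have h1 : z ^ n * z ^ (k - n) = z ^ n * 1 := by
    rw [← pow_add, mul_one, he]
    congr 1
    omega
  exact mul_left_cancel₀ (pow_ne_zero n hz0) h1

end IntegerRep

/-! ### The common criterion and the equivalence -/

variable {m : ℕ}

/-- Needed because tame representations must have positive dimension, while the integer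
representation of f = 0 has dimension zero. -/
theorem zero_mem_S₀ : (0 : List (Fin m) → ℂ) ∈ S₀ m := by
  refine ⟨1, one_pos, 1, 0, 0, ?_, fun u => by simp⟩
  refine generatesTame_of_aeval_eq_zero (P := X - C 1) (X_sub_C_ne_zero 1) fun B hB => ?_
  have hB1 : B = 1 := by
    have hle : Submonoid.closure (Set.range (1 : Fin m → Matrix (Fin 1) (Fin 1) ℂ)) ≤ ⊥ := by
      rw [Submonoid.closure_le]
      rintro _ ⟨a, rfl⟩
      exact Submonoid.mem_bot.2 rfl
    exact Submonoid.mem_bot.1 (hle hB)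
  subst hB1
  simp [Module.End.one_eq_id]

/-- A regular integer sequence has both a tame representation and an expression by automatic
sequences if the geometric progressions along powers of words, in the span of its translates,
stay in the unit disc. -/
theorem mem_S₀_and_mem_R₀ {f : List (Fin m) → ℤ} (hf : IsRegular ℤ f)
    (h : ∀ g ∈ translates (toComplex f), ∀ (u : List (Fin m)) (z : ℂ),
      (∀ n, g (List.replicate n u).flatten = z ^ n) → ‖z‖ ≤ 1) :
    toComplex f ∈ S₀ m ∧ (toComplex f : ConvAlg m) ∈ R₀ m := by
  obtain ⟨d, A, v, w, hfA, hA⟩ := hf.exists_rep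
  obtain ⟨P, hP, hPA⟩ := exists_common_annihilator d
  have hann : ∀ u : List (Fin m),
      aeval (Matrix.toLin' (u.map fun a => complexify (A a)).prod) P = 0 := fun u => by
    rw [prod_map_complexify]
    refine hPA _ fun z hz => ?_
    obtain ⟨g, hg, hgz⟩ := exists_mem_eq_pow_of_hasEigenvalue hA u hz
    exact h g hg u z hgz
  have hrep : ∀ u : List (Fin m), toComplex f u = (fun i => (w i : ℂ)) ⬝ᵥ
      (u.map fun a => complexify (A a)).prod.mulVec fun i => (v i : ℂ) := fun u => by
    rw [prod_map_complexify, toComplex, hfA]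
    simp [dotProduct, Matrix.mulVec, complexify]
  constructor
  · rcases Nat.eq_zero_or_pos d with rfl | hd
    · have : toComplex f = 0 := by
        funext u
        rw [hrep]
        simp
      rw [this]
      exact zero_mem_S₀
    · refine ⟨d, hd, fun a => complexify (A a), _, _, ?_, hrep⟩
      refine generatesTame_of_aeval_eq_zero hP fun B hB => ?_
      obtain ⟨u, rfl⟩ := exists_prod_map_of_mem_closure _ hB
      exact hann u
  · have hprod : ∀ u : List (Fin m), (u.map fun a => Matrix.toLin' (complexify (A a))).prod =
        Matrix.toLin' (u.map fun a => complexify (A a)).prod := fun u => by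
      induction u with
      | nil => simp [Module.End.one_eq_id]
      | cons a u ih => simp [ih, Matrix.toLin'_mul, Module.End.mul_eq_comp]
    have := coef_mem_R₀ hP d (Fin d → ℂ) (by simp) (fun a => Matrix.toLin' (complexify (A a)))
      (fun u => by rw [hprod]; exact hann u)
      (dotProductBilin ℂ ℂ fun i => (w i : ℂ)) (fun i => (v i : ℂ))
    refine Eq.mp (congrArg (· ∈ R₀ m) (funext fun u => ?_)) this
    rw [coef, hprod]
    exact (hrep u).symm

end RegularSeq

theorem theorem3p2 (m : ℕ) (f : List (Fin m) → ℤ) (hf : RegularSeq.IsRegular ℤ f) :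
    List.TFAE [
      (RegularSeq.toComplex f : RegularSeq.ConvAlg m) ∈ RegularSeq.R₀ m,
      RegularSeq.toComplex f ∈ RegularSeq.S₀ m,
      RegularSeq.IsPolyBounded (RegularSeq.toComplex f)] := by
  tfae_have 1 → 3 := RegularSeq.isPolyBounded_of_mem_R₀
  tfae_have 3 → 2 := fun h => (RegularSeq.mem_S₀_and_mem_R₀ hf fun _ hg u _ hz =>
    RegularSeq.norm_le_one_of_isPolyBounded
      (RegularSeq.isPolyBounded_of_mem_translates h hg) u hz).1
  tfae_have 2 → 1 := fun h => (RegularSeq.mem_S₀_and_mem_R₀ hf fun _ hg u _ hz =>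
    RegularSeq.norm_le_one_of_mem_S₀ h hg u hz).2
  tfae_finish
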